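/- Equip $\mathbb{C}^3$ with its standard Hermitian form, and define the cross ratio of two points $[w],[z]\in\mathbb{CP}^2$ by $\kappa([w],[z])=|\langle w,z\rangle|^2/(\|w\|^2\|z\|^2)$. A SIC set in $\mathbb{CP}^2$ is a set of nine (distinct) points for which there is a constant $\kappa\in[0,1)$ such that any two distinct points of the set have cross ratio $\kappa$ (necessarily $\kappa=1/4$). For $i=1,2,3$ let $C_i\subset\mathbb{CP}^2$ be the circle of points $[z_1,z_2,z_3]$ with $z_i=0$ and $|z_j|=|z_k|$, where $\{i,j,k\}=\{1,2,3\}$. A midpoint solution is a SIC set in $\mathbb{CP}^2$ consisting of three (necessarily equally spaced) points in each of the three circles $C_1,C_2,C_3$. Theorem. Every SIC set $\mathbb{S}$ in $\mathbb{CP}^2$ is congruent modulo $\mathrm{SU}(3)$ to a midpoint solution; that is, there is a matrix $U\in\mathrm{SU}(3)$ such that $\{[Uz]:[z]\in\mathbb{S}\}$ is a midpoint solution. -/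

import Mathlib

open scoped LinearAlgebra.Projectivization

namespace SIC

/-- The complex vector space `ℂⁿ` of column vectors with its standard Hermitian form. -/
abbrev V (n : ℕ) : Type := EuclideanSpace ℂ (Fin n)

/-- `CP n` is the projective space `ℂℙⁿ⁻¹ = (ℂⁿ ∖ 0) / ℂˣ`, so the projective plane is `CP 3`. -/
abbrev CP (n : ℕ) : Type := ℙ ℂ (V n)

/-- The cross ratio `|⟨w, z⟩|² / (‖w‖² ‖z‖²)` of two points `[w], [z]` of `ℂℙⁿ⁻¹`. It does not
depend on the representatives, see `crossRatio_mk`. -/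
noncomputable def crossRatio {n : ℕ} (p q : CP n) : ℝ :=
  ‖inner ℂ p.rep q.rep‖ ^ 2 / (‖p.rep‖ ^ 2 * ‖q.rep‖ ^ 2)

theorem crossRatio_mk {n : ℕ} (w z : V n) (hw : w ≠ 0) (hz : z ≠ 0) :
    crossRatio (Projectivization.mk ℂ w hw) (Projectivization.mk ℂ z hz) =
      ‖inner ℂ w z‖ ^ 2 / (‖w‖ ^ 2 * ‖z‖ ^ 2) := by
  obtain ⟨a, ha⟩ := Projectivization.exists_smul_eq_mk_rep ℂ w hw
  obtain ⟨b, hb⟩ := Projectivization.exists_smul_eq_mk_rep ℂ z hz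
  have ha0 : ‖(a : ℂ)‖ ≠ 0 := norm_ne_zero_iff.mpr a.ne_zero
  have hb0 : ‖(b : ℂ)‖ ≠ 0 := norm_ne_zero_iff.mpr b.ne_zero
  have hw0 : ‖w‖ ≠ 0 := norm_ne_zero_iff.mpr hw
  have hz0 : ‖z‖ ≠ 0 := norm_ne_zero_iff.mpr hz
  unfold crossRatio
  rw [← ha, ← hb]
  simp only [Units.smul_def, inner_smul_left, inner_smul_right, norm_mul, norm_smul,
    RCLike.norm_conj]
  field_simp

/-- A SIC set in `ℂℙⁿ⁻¹`: a set of `n²` mutually equidistant points, that is, any two distinct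
points have the same cross ratio `κ ∈ [0, 1)`. -/
def IsSICSet {n : ℕ} (S : Set (CP n)) : Prop :=
  S.ncard = n ^ 2 ∧
    ∃ κ : ℝ, 0 ≤ κ ∧ κ < 1 ∧ ∀ p ∈ S, ∀ q ∈ S, p ≠ q → crossRatio p q = κ

/-- The circle `C_i` in the projective plane: all points `[z₁, z₂, z₃]` with `z_i = 0` whose two
other coordinates have equal modulus. -/
def circle (i : Fin 3) : Set (CP 3) :=
  {p | ∃ (z : V 3) (hz : z ≠ 0), p = Projectivization.mk ℂ z hz ∧
    z i = 0 ∧ ∀ j k, j ≠ i → k ≠ i → ‖z j‖ = ‖z k‖}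

/-- A midpoint solution: a SIC set in the projective plane consisting of three points in each of
the (pairwise disjoint) circles `C₁, C₂, C₃`. -/
def IsMidpointSolution (S : Set (CP 3)) : Prop :=
  IsSICSet S ∧ S ⊆ (⋃ i, circle i) ∧ ∀ i, (S ∩ circle i).ncard = 3

theorem toEuclideanLin_injective {n : ℕ} (U : Matrix.specialUnitaryGroup (Fin n) ℂ) :
    Function.Injective (Matrix.toEuclideanLin (U : Matrix (Fin n) (Fin n) ℂ)) := by
  have hU : star (U : Matrix (Fin n) (Fin n) ℂ) * U = 1 :=
    Matrix.mem_unitaryGroup_iff'.mp (Matrix.mem_specialUnitaryGroup_iff.mp U.2).1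
  intro x y hxy
  have h := congrArg (fun v : V n => (star (U : Matrix (Fin n) (Fin n) ℂ)).mulVec v.ofLp) hxy
  exact WithLp.ofLp_injective 2 (by simpa [Matrix.toLpLin_apply, Matrix.mulVec_mulVec, hU] using h)

/-- The action of `SU(n)` on `ℂℙⁿ⁻¹`: the matrix `U` maps `[z]` to `[U z]`. -/
noncomputable def suAct {n : ℕ} (U : Matrix.specialUnitaryGroup (Fin n) ℂ) : CP n → CP n :=
  Projectivization.map (Matrix.toEuclideanLin (U : Matrix (Fin n) (Fin n) ℂ))
    (toEuclideanLin_injective U)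

/-- Two subsets of `ℂℙⁿ⁻¹` are congruent modulo `SU(n)`. -/
def CongruentModSU {n : ℕ} (S T : Set (CP n)) : Prop :=
  ∃ U : Matrix.specialUnitaryGroup (Fin n) ℂ, suAct U '' S = T

end SIC

/-! Choose unit representatives `x i`. Their nine rank-one projectors are independent, hence a basis
of the 3×3 matrices. Expanding the identity in this basis forces `κ = 1/4` and `G² = 3G` for the
Gram matrix `G`; expanding `x_l x_k*` gives an analogous identity for the entrywise square of `G`.
So `h = 3 - 2G` is Hermitian, unimodular, with unit diagonal and `h² = 9`, and its entrywise square
has the same properties. Conversely every such matrix comes from an equiangular family, so the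
squaring can be iterated (`IsPhaseMatrix.sq`).

For fixed `i ≠ j` the nine triple products `h i j * h j k * h k i` therefore have vanishing first,
second and fourth power sums. Newton's identities and unimodularity make their monic polynomial a
cubic in `X³`. The value 1 occurs at `k = i` and `k = j`, so that cubic is `(Y - 1)²(Y - ε)`
(`cube_eq_of_power_sums`). A counting argument then yields distinct indices with triple product 1
(`exists_triple_eq_one`).

Such a triple spans only a plane. The Fourier combinations of its three vectors form an orthonormal
pair, and the relation among the three makes every other triple product with the first two a
primitive cube root of unity. The value 1, ω or ω² decides the circle on which each point lies
(`exists_frame`). -/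

namespace SIC

open Matrix

/-! ### Equiangular families and the projector basis -/

/-- Nine unit vectors of `ℂ³` whose pairwise inner products have squared modulus `κ ≠ 1`. -/
structure IsEquiangular (x : Fin 9 → Fin 3 → ℂ) (κ : ℂ) : Prop where
  ne_one : κ ≠ 1
  unit : ∀ i, star (x i) ⬝ᵥ x i = 1
  angle : ∀ i j, i ≠ j → (star (x i) ⬝ᵥ x j) * (star (x j) ⬝ᵥ x i) = κ

theorem dotProduct_vecMulVec_mulVec (a b c d : Fin 3 → ℂ) :
    a ⬝ᵥ (vecMulVec b c *ᵥ d) = (a ⬝ᵥ b) * (c ⬝ᵥ d) := by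
  simp [Fin.sum_univ_three, dotProduct, mulVec, vecMulVec]
  ring

namespace IsEquiangular

variable {x : Fin 9 → Fin 3 → ℂ} {κ : ℂ}

theorem sum_mul_angle (hx : IsEquiangular x κ) (c : Fin 9 → ℂ) (j : Fin 9) :
    ∑ i, c i * ((star (x j) ⬝ᵥ x i) * (star (x i) ⬝ᵥ x j)) =
      κ * ∑ i, c i + (1 - κ) * c j := by
  have h : ∀ i, c i * ((star (x j) ⬝ᵥ x i) * (star (x i) ⬝ᵥ x j)) =
      κ * c i + if i = j then (1 - κ) * c i else 0 := by
    intro i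
    split_ifs with hij
    · subst hij
      rw [hx.unit]
      ring
    · rw [hx.angle j i (Ne.symm hij)]
      ring
  rw [Finset.sum_congr rfl fun i _ => h i, Finset.sum_add_distrib, ← Finset.mul_sum]
  simp

theorem dotProduct_sum (c : Fin 9 → ℂ) (a b : Fin 3 → ℂ) :
    a ⬝ᵥ ((∑ i, c i • vecMulVec (x i) (star (x i))) *ᵥ b) =
      ∑ i, c i * ((a ⬝ᵥ x i) * (star (x i) ⬝ᵥ b)) := by
  rw [sum_mulVec, _root_.dotProduct_sum]
  refine Finset.sum_congr rfl fun i _ => ?_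
  rw [smul_mulVec, dotProduct_smul, dotProduct_vecMulVec_mulVec, smul_eq_mul]

theorem trace_sum (hx : IsEquiangular x κ) (c : Fin 9 → ℂ) :
    (∑ i, c i • vecMulVec (x i) (star (x i))).trace = ∑ i, c i := by
  rw [Matrix.trace_sum]
  refine Finset.sum_congr rfl fun i _ => ?_
  rw [Matrix.trace_smul, trace_vecMulVec, dotProduct_comm, hx.unit, smul_eq_mul, mul_one]

/-- In a vanishing combination the trace gives `∑ c = 0`; pairing with the `j`-th vector then leaves
`(1 - κ) c j = 0`. -/
theorem linearIndependent (hx : IsEquiangular x κ) :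
    LinearIndependent ℂ fun i => vecMulVec (x i) (star (x i)) := by
  rw [Fintype.linearIndependent_iff]
  intro c hc j
  have h1 := hx.trace_sum c
  have h2 := dotProduct_sum (x := x) c (star (x j)) (x j)
  rw [hc] at h1 h2
  rw [hx.sum_mul_angle, ← h1] at h2
  simp only [trace_zero, zero_mulVec, dotProduct_zero, mul_zero, zero_add] at h2
  exact (mul_eq_zero.mp h2.symm).resolve_left (sub_ne_zero.mpr hx.ne_one.symm)

theorem exists_eq_sum (hx : IsEquiangular x κ) (A : Matrix (Fin 3) (Fin 3) ℂ) :
    ∃ c : Fin 9 → ℂ, A = ∑ i, c i • vecMulVec (x i) (star (x i)) := by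
  have h := hx.linearIndependent.span_eq_top_of_card_eq_finrank (by simp [Module.finrank_matrix])
  have hA : A ∈ Submodule.span ℂ (Set.range fun i => vecMulVec (x i) (star (x i))) := by
    rw [h]; trivial
  obtain ⟨c, hc⟩ := (Submodule.mem_span_range_iff_exists_fun ℂ).mp hA
  exact ⟨c, hc.symm⟩

/-- The identity has coefficients of sum 3 satisfying `1 = 3κ + (1 - κ) c j`; summing over the nine
`j` gives `9 = 27κ + 3(1 - κ)`. -/
theorem eq_quarter (hx : IsEquiangular x κ) : κ = 1 / 4 := by
  obtain ⟨c, hc⟩ := hx.exists_eq_sum 1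
  have h1 := hx.trace_sum c
  rw [← hc] at h1
  simp only [trace_one, Fintype.card_fin, Nat.cast_ofNat] at h1
  have h2 : ∀ j, 1 = κ * 3 + (1 - κ) * c j := by
    intro j
    rw [h1, ← hx.sum_mul_angle, ← dotProduct_sum, ← hc, one_mulVec, hx.unit]
  have h3 : ∑ j : Fin 9, (1 : ℂ) = ∑ j, (κ * 3 + (1 - κ) * c j) :=
    Finset.sum_congr rfl fun j _ => h2 j
  rw [Finset.sum_add_distrib, ← Finset.mul_sum _ _ (1 - κ), ← h1] at h3
  simp only [Finset.sum_const, Finset.card_univ, Fintype.card_fin, nsmul_eq_mul,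
    Nat.cast_ofNat] at h3
  linear_combination (-1 / 24 : ℂ) * h3

/-- The expansion of a matrix in the projectors onto the vectors of an equiangular family. -/
theorem dotProduct_mulVec_eq (hx : IsEquiangular x κ) (A : Matrix (Fin 3) (Fin 3) ℂ)
    (a b : Fin 3 → ℂ) :
    a ⬝ᵥ (A *ᵥ b) = ∑ i, (4 / 3 * (star (x i) ⬝ᵥ (A *ᵥ x i)) - A.trace / 3) *
      ((a ⬝ᵥ x i) * (star (x i) ⬝ᵥ b)) := by
  obtain ⟨c, rfl⟩ := hx.exists_eq_sum A
  rw [dotProduct_sum]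
  refine Finset.sum_congr rfl fun i _ => ?_
  rw [dotProduct_sum, hx.trace_sum, hx.sum_mul_angle, hx.eq_quarter]
  ring

theorem sum_mul (hx : IsEquiangular x κ) (k l : Fin 9) :
    ∑ i, (star (x k) ⬝ᵥ x i) * (star (x i) ⬝ᵥ x l) = 3 * (star (x k) ⬝ᵥ x l) := by
  have h := hx.dotProduct_mulVec_eq 1 (star (x k)) (x l)
  simp only [one_mulVec, hx.unit, trace_one, Fintype.card_fin, Nat.cast_ofNat,
    ← Finset.mul_sum] at h
  linear_combination (-3 : ℂ) * h

/-- This is the expansion of the rank-one matrix `x_l x_k*`, paired with `x_k` and `x_l`; the trace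
term is evaluated by `sum_mul`. -/
theorem sum_sq_mul_sq (hx : IsEquiangular x κ) (k l : Fin 9) :
    ∑ i, (star (x k) ⬝ᵥ x i) ^ 2 * (star (x i) ⬝ᵥ x l) ^ 2 =
      3 / 2 * (star (x k) ⬝ᵥ x l) ^ 2 := by
  have h := hx.dotProduct_mulVec_eq (vecMulVec (x l) (star (x k))) (star (x k)) (x l)
  have h' : ∀ i, (4 / 3 * (star (x i) ⬝ᵥ (vecMulVec (x l) (star (x k)) *ᵥ x i)) -
      (vecMulVec (x l) (star (x k))).trace / 3) *
        ((star (x k) ⬝ᵥ x i) * (star (x i) ⬝ᵥ x l)) =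
      4 / 3 * ((star (x k) ⬝ᵥ x i) ^ 2 * (star (x i) ⬝ᵥ x l) ^ 2) -
        (star (x k) ⬝ᵥ x l) / 3 * ((star (x k) ⬝ᵥ x i) * (star (x i) ⬝ᵥ x l)) := by
    intro i
    rw [dotProduct_vecMulVec_mulVec, trace_vecMulVec, dotProduct_comm (x l)]
    ring
  rw [Finset.sum_congr rfl fun i _ => h' i, Finset.sum_sub_distrib, ← Finset.mul_sum,
    ← Finset.mul_sum, hx.sum_mul, dotProduct_vecMulVec_mulVec] at h
  linear_combination (-3 / 4 : ℂ) * h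

end IsEquiangular

/-! ### Phase matrices and closure under entrywise squaring -/

/-- A Hermitian complex Hadamard matrix of order nine with unit diagonal. -/
structure IsPhaseMatrix (h : Matrix (Fin 9) (Fin 9) ℂ) : Prop where
  norm_eq : ∀ i j, ‖h i j‖ = 1
  star_eq : ∀ i j, star (h i j) = h j i
  diag : ∀ i, h i i = 1
  sum_eq : ∀ i j, i ≠ j → ∑ k, h i k * h k j = 0

/-- The Gram matrix of a family of vectors. -/
def gram (x : Fin 9 → Fin 3 → ℂ) : Matrix (Fin 9) (Fin 9) ℂ :=
  of fun i j => star (x i) ⬝ᵥ x j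

/-- The matrix `3 - 2G`, where `G` is the Gram matrix of the family. -/
def phaseMatrix (x : Fin 9 → Fin 3 → ℂ) : Matrix (Fin 9) (Fin 9) ℂ :=
  (3 : ℂ) • 1 + (-2 : ℂ) • gram x

/-- The square of `α + βB` is `α² + β(2α + βγ)B`, so the hypothesis on `γ` makes it scalar. -/
theorem sum_mul_smul_add (B : Matrix (Fin 9) (Fin 9) ℂ) (α β γ : ℂ) (hB : B * B = γ • B)
    (hγ : 2 * α + β * γ = 0) (i j : Fin 9) (hij : i ≠ j) :
    ∑ k, (α • (1 : Matrix (Fin 9) (Fin 9) ℂ) + β • B) i k *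
      (α • (1 : Matrix (Fin 9) (Fin 9) ℂ) + β • B) k j = 0 := by
  rw [← mul_apply]
  have h : (α • (1 : Matrix (Fin 9) (Fin 9) ℂ) + β • B) *
      (α • (1 : Matrix (Fin 9) (Fin 9) ℂ) + β • B) =
      (α * α) • 1 + (β * (2 * α + β * γ)) • B := by
    simp only [add_mul, mul_add, smul_mul_assoc, mul_smul_comm, one_mul, mul_one, hB]
    module
  rw [h, hγ]
  simp [hij]

theorem star_dotProduct_star_comm (a b : Fin 3 → ℂ) : star (star a ⬝ᵥ b) = star b ⬝ᵥ a := by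
  simp [dotProduct, Fin.sum_univ_three, mul_comm]

theorem phaseMatrix_ne (x : Fin 9 → Fin 3 → ℂ) {i j : Fin 9} (hij : i ≠ j) :
    phaseMatrix x i j = -2 * (star (x i) ⬝ᵥ x j) := by
  simp [phaseMatrix, gram, hij]

namespace IsEquiangular

variable {x : Fin 9 → Fin 3 → ℂ} {κ : ℂ}

theorem phaseMatrix_self (hx : IsEquiangular x κ) (i : Fin 9) : phaseMatrix x i i = 1 := by
  simp [phaseMatrix, gram, hx.unit i]
  norm_num

theorem star_phaseMatrix (x : Fin 9 → Fin 3 → ℂ) (i j : Fin 9) :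
    star (phaseMatrix x i j) = phaseMatrix x j i := by
  by_cases hij : i = j
  · subst hij
    simp [phaseMatrix, gram, star_dotProduct_star_comm]
  · rw [phaseMatrix_ne x hij, phaseMatrix_ne x (Ne.symm hij), star_mul',
      star_dotProduct_star_comm]
    simp

theorem norm_phaseMatrix (hx : IsEquiangular x κ) (i j : Fin 9) : ‖phaseMatrix x i j‖ = 1 := by
  by_cases hij : i = j
  · subst hij
    simp [hx.phaseMatrix_self]
  · have h : phaseMatrix x i j * star (phaseMatrix x i j) = 1 := by
      rw [star_phaseMatrix, phaseMatrix_ne x hij, phaseMatrix_ne x (Ne.symm hij)]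
      linear_combination 4 * (hx.angle i j hij).trans hx.eq_quarter
    rw [Complex.star_def, Complex.mul_conj'] at h
    have h' : ‖phaseMatrix x i j‖ ^ 2 = 1 := by exact_mod_cast h
    exact (pow_eq_one_iff_of_nonneg (norm_nonneg _) two_ne_zero).mp h'

theorem isPhaseMatrix (hx : IsEquiangular x κ) : IsPhaseMatrix (phaseMatrix x) where
  norm_eq := hx.norm_phaseMatrix
  star_eq := star_phaseMatrix x
  diag := hx.phaseMatrix_self
  sum_eq := sum_mul_smul_add (gram x) 3 (-2) 3
    (by ext i j; simp [mul_apply, gram, hx.sum_mul]) (by norm_num)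

theorem isPhaseMatrix_sq (hx : IsEquiangular x κ) :
    IsPhaseMatrix (of fun i j => phaseMatrix x i j ^ 2) where
  norm_eq i j := by simp [hx.norm_phaseMatrix]
  star_eq i j := by simp [← star_phaseMatrix x i j]
  diag i := by simp [hx.phaseMatrix_self]
  sum_eq := by
    have h := sum_mul_smul_add (of fun i j => gram x i j ^ 2) (-3) 4 (3 / 2)
      (by ext i j; simp [mul_apply, gram, hx.sum_sq_mul_sq]) (by norm_num)
    have h' : (of fun i j => phaseMatrix x i j ^ 2) =
        (-3 : ℂ) • (1 : Matrix (Fin 9) (Fin 9) ℂ) + (4 : ℂ) • of fun i j => gram x i j ^ 2 := by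
      ext i j
      by_cases hij : i = j
      · subst hij
        simp [hx.phaseMatrix_self, gram, hx.unit]
        norm_num
      · simp [phaseMatrix_ne x hij, gram, hij]
        ring
    rwa [h']

end IsEquiangular

namespace IsPhaseMatrix

variable {h : Matrix (Fin 9) (Fin 9) ℂ}

theorem mul_star (hh : IsPhaseMatrix h) (i j : Fin 9) : h i j * h j i = 1 := by
  rw [← hh.star_eq i j, Complex.star_def, Complex.mul_conj', hh.norm_eq]
  norm_num

theorem mul_self (hh : IsPhaseMatrix h) : h * h = (9 : ℂ) • 1 := by
  ext i j
  by_cases hij : i = j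
  · subst hij
    simp [mul_apply, hh.mul_star]
  · simp [mul_apply, hh.sum_eq i j hij, hij]

/-- Every phase matrix comes from an equiangular family in `ℂ³`. -/
theorem exists_isEquiangular (hh : IsPhaseMatrix h) :
    ∃ x, IsEquiangular x (1 / 4) ∧ phaseMatrix x = h := by
  -- This inverts `h = 3 - 2G` with `Q = G / 3`: since `h² = 9`, it is the projection onto the
  -- eigenspace of `h` for -3, of rank `tr Q = 3`.
  set Q : Matrix (Fin 9) (Fin 9) ℂ := (1 / 2 : ℂ) • 1 - (1 / 6 : ℂ) • h with hQ
  have hQQ : Q * Q = Q := by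
    rw [hQ]
    simp only [sub_mul, mul_sub, smul_mul_assoc, mul_smul_comm, one_mul, mul_one, hh.mul_self]
    module
  have hQs : Qᴴ = Q := by
    have hs : hᴴ = h := by
      ext i j
      rw [conjTranspose_apply, hh.star_eq]
    rw [hQ, conjTranspose_sub, conjTranspose_smul, conjTranspose_smul, conjTranspose_one, hs]
    simp
  have htr : Q.trace = 3 := by
    simp [hQ, Matrix.trace, hh.diag]
    norm_num
  set f := Matrix.toEuclideanLin Q
  have hf : LinearMap.IsProj (LinearMap.range f) f := by
    refine ⟨fun v => ⟨v, rfl⟩, ?_⟩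
    rintro _ ⟨v, rfl⟩
    simp only [f, Matrix.toLpLin_apply, mulVec_mulVec, hQQ]
  have hfr : Module.finrank ℂ (LinearMap.range f) = 3 := by
    have h1 := hf.trace
    have h2 : LinearMap.trace ℂ _ f = Q.trace := by
      rw [show f = Matrix.toLin (PiLp.basisFun 2 ℂ (Fin 9)) (PiLp.basisFun 2 ℂ (Fin 9)) Q from
        congrFun (congrArg DFunLike.coe (Matrix.toLpLin_eq_toLin 2 2)) Q, Matrix.trace_toLin_eq]
    rw [h2, htr] at h1
    exact_mod_cast h1.symm
  let B := (stdOrthonormalBasis ℂ (LinearMap.range f)).reindex (finCongr hfr)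
  let y : Fin 9 → LinearMap.range f := fun i => ⟨f (WithLp.toLp 2 (Pi.single i 1)), ⟨_, rfl⟩⟩
  -- The columns of `Q` have squared norm 1/3; the factor `√3` makes them unit vectors.
  let x : Fin 9 → Fin 3 → ℂ := fun i => (Real.sqrt 3 : ℂ) • (B.repr (y i)).ofLp
  have hsqrt : (Real.sqrt 3 : ℂ) * Real.sqrt 3 = 3 := by
    rw [← Complex.ofReal_mul, Real.mul_self_sqrt (by norm_num)]
    norm_num
  have hy : ∀ i j, inner ℂ (y i) (y j) = Q i j := by
    intro i j
    simp only [y, Submodule.coe_inner, f, Matrix.toLpLin_apply]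
    rw [EuclideanSpace.inner_toLp_toLp]
    simp only [mulVec_single_one]
    have := congrFun (congrFun hQQ i) j
    rw [mul_apply] at this
    rw [← this]
    refine Finset.sum_congr rfl fun k _ => ?_
    have h3 := congrFun (congrFun hQs i) k
    rw [conjTranspose_apply] at h3
    simp only [Pi.star_apply, col_apply, h3]
    ring
  have hg : ∀ i j, star (x i) ⬝ᵥ x j = 3 * Q i j := by
    intro i j
    have h4 : star (B.repr (y i)).ofLp ⬝ᵥ (B.repr (y j)).ofLp = Q i j := by
      rw [dotProduct_comm, ← EuclideanSpace.inner_eq_star_dotProduct,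
        LinearIsometryEquiv.inner_map_map, hy]
    simp only [x]
    rw [star_smul, smul_dotProduct, dotProduct_smul, h4, Complex.star_def, Complex.conj_ofReal,
      smul_eq_mul, smul_eq_mul, ← mul_assoc, hsqrt]
  refine ⟨x, ⟨by norm_num, fun i => ?_, fun i j hij => ?_⟩, ?_⟩
  · rw [hg]
    simp [hQ, hh.diag]
    norm_num
  · rw [hg, hg]
    simp [hQ, hij, Ne.symm hij]
    linear_combination (1 / 4 : ℂ) * hh.mul_star i j
  · ext i j
    simp [phaseMatrix, gram, hg, hQ]
    ring

/-- The entrywise square of a phase matrix is a phase matrix. -/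
theorem sq (hh : IsPhaseMatrix h) : IsPhaseMatrix (of fun i j => h i j ^ 2) := by
  obtain ⟨x, hx, rfl⟩ := hh.exists_isEquiangular
  exact hx.isPhaseMatrix_sq

end IsPhaseMatrix

/-! ### Unimodular numbers with vanishing power sums -/

-- Newton's identities kill `e 1`, `e 2` and `e 4`; conjugate symmetry of unimodular roots then
-- kills `e 8`, `e 7` and `e 5`.
open Polynomial in
theorem prod_X_sub_C_eq_of_power_sums (v : Fin 9 → ℂ) (hv : ∀ k, ‖v k‖ = 1)
    (p1 : ∑ k, v k = 0) (p2 : ∑ k, v k ^ 2 = 0) (p4 : ∑ k, v k ^ 4 = 0) :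
    ∃ a b : ℂ, (∏ k, (X - C (v k)) = X ^ 9 - C a * X ^ 6 + C b * X ^ 3 - C (∏ k, v k)) ∧
      ∑ k, v k ^ 3 = 3 * a := by
  set e : ℕ → ℂ := fun m => MvPolynomial.aeval v (MvPolynomial.esymm (Fin 9) ℂ m) with he
  have e_eq : ∀ m, e m = ∑ s ∈ Finset.powersetCard m Finset.univ, ∏ i ∈ s, v i := by
    intro m
    simp [he, MvPolynomial.esymm]
  have newton : ∀ m, m * e m = (-1) ^ (m + 1) *
      ∑ a ∈ Finset.HasAntidiagonal.antidiagonal m with a.1 < m, (-1) ^ a.1 * e a.1 * ∑ k, v k ^ a.2 := by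
    intro m
    have := congrArg (MvPolynomial.aeval v) (MvPolynomial.mul_esymm_eq_sum (Fin 9) ℂ m)
    simpa [he, MvPolynomial.psum] using this
  have e0 : e 0 = 1 := by simp [he]
  have n1 := newton 1
  have n2 := newton 2
  have n3 := newton 3
  have n4 := newton 4
  rw [show (Finset.HasAntidiagonal.antidiagonal 1).filter (fun a => a.1 < 1) = {(0, 1)} by decide] at n1
  rw [show (Finset.HasAntidiagonal.antidiagonal 2).filter (fun a => a.1 < 2) = {(0, 2), (1, 1)} by decide] at n2
  rw [show (Finset.HasAntidiagonal.antidiagonal 3).filter (fun a => a.1 < 3) = {(0, 3), (1, 2), (2, 1)}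
    by decide] at n3
  rw [show (Finset.HasAntidiagonal.antidiagonal 4).filter (fun a => a.1 < 4) = {(0, 4), (1, 3), (2, 2), (3, 1)}
    by decide] at n4
  simp [p1] at n1
  simp [p1, p2, n1] at n2
  norm_num [p1, p2, e0] at n3
  simp [p1, p2, p4, n1] at n4
  -- Complementation matches the subsets; a unimodular product has its conjugate as inverse.
  have dual : ∀ m, m ≤ 9 → e (9 - m) = (∏ k, v k) * star (e m) := by
    intro m hm
    rw [e_eq, e_eq, star_sum, Finset.mul_sum]
    refine Finset.sum_nbij' (fun s => sᶜ) (fun s => sᶜ) ?_ ?_ (by simp) (by simp) ?_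
    · intro s hs
      rw [Finset.mem_powersetCard_univ] at hs ⊢
      rw [Finset.card_compl, hs, Fintype.card_fin]
      omega
    · intro s hs
      rw [Finset.mem_powersetCard_univ] at hs ⊢
      rw [Finset.card_compl, hs, Fintype.card_fin]
    · intro s _
      have h1 : (∏ i ∈ sᶜ, v i) * star (∏ i ∈ sᶜ, v i) = 1 := by
        rw [star_prod, ← Finset.prod_mul_distrib]
        refine Finset.prod_eq_one fun i _ => ?_
        rw [Complex.star_def, Complex.mul_conj', hv]
        norm_num
      rw [← Finset.prod_mul_prod_compl s, mul_assoc, h1, mul_one]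
  have e5 : e 5 = 0 := by simpa [n4] using dual 4 (by norm_num)
  have e7 : e 7 = 0 := by simpa [n2] using dual 2 (by norm_num)
  have e8 : e 8 = 0 := by simpa [n1] using dual 1 (by norm_num)
  have e9 : e 9 = ∏ k, v k := by simpa [e0] using dual 0 (by norm_num)
  refine ⟨e 3, e 6, ?_, n3.symm⟩
  have h := Multiset.prod_X_sub_X_eq_sum_esymm ((Finset.univ : Finset (Fin 9)).val.map v)
  have h' : ∀ m, ((Finset.univ : Finset (Fin 9)).val.map v).esymm m = e m := fun m =>
    (MvPolynomial.aeval_esymm_eq_multiset_esymm (Fin 9) ℂ m v).symm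
  simp only [Multiset.map_map, Multiset.card_map, h', Finset.card_val, Finset.card_univ,
    Fintype.card_fin, Function.comp_def] at h
  rw [Finset.prod_eq_multiset_prod, h]
  simp only [Finset.sum_range_succ, Finset.sum_range_zero, e0, n1, n2, n4, e5, e7, e8, e9, map_zero,
    map_one]
  ring

open Polynomial in
/-- Nine unimodular numbers, two of them equal to one, with vanishing first, second and fourth
power sums: their cubes take the value one six times and a common value `ε` three times. -/
theorem cube_eq_of_power_sums (v : Fin 9 → ℂ) (hv : ∀ k, ‖v k‖ = 1) {i j : Fin 9} (hij : i ≠ j)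
    (hi : v i = 1) (hj : v j = 1)
    (p1 : ∑ k, v k = 0) (p2 : ∑ k, v k ^ 2 = 0) (p4 : ∑ k, v k ^ 4 = 0) :
    ∃ ε : ℂ, (∀ k, v k ^ 3 = 1 ∨ v k ^ 3 = ε) ∧ ∑ k, v k ^ 3 = 6 + 3 * ε := by
  obtain ⟨a, b, hP, hs⟩ := prod_X_sub_C_eq_of_power_sums v hv p1 p2 p4
  set ε := ∏ k, v k
  have hdvd : ∃ R : ℂ[X], ∏ k, (X - C (v k)) = (X - 1) ^ 2 * R := by
    refine ⟨∏ k ∈ ({i, j} : Finset (Fin 9))ᶜ, (X - C (v k)), ?_⟩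
    rw [← Finset.prod_mul_prod_compl {i, j}, Finset.prod_pair hij, hi, hj, C_1, sq]
  obtain ⟨R, hR⟩ := hdvd
  -- The double root at 1 gives two linear equations, from the value and the derivative, which
  -- determine `a` and `b`.
  have hd := congrArg (fun p => eval 1 (derivative p)) (hP.symm.trans hR)
  have h1 := congrArg (eval 1) (hP.symm.trans hR)
  simp at h1
  simp [derivative_pow] at hd
  have ha : a = 2 + ε := by linear_combination h1 - hd / 3
  have hb : b = 1 + 2 * ε := by linear_combination 2 * h1 - hd / 3
  refine ⟨ε, fun k => ?_, by rw [hs, ha]; ring⟩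
  have h0 : eval (v k) (∏ k, (X - C (v k))) = 0 := by
    rw [eval_prod]
    exact Finset.prod_eq_zero (Finset.mem_univ k) (by simp)
  rw [hP] at h0
  simp [ha, hb] at h0
  have h2 : (v k ^ 3 - 1) ^ 2 * (v k ^ 3 - ε) = 0 := by linear_combination h0
  rcases mul_eq_zero.mp h2 with h | h
  · exact Or.inl (sub_eq_zero.mp (pow_eq_zero_iff (two_ne_zero) |>.mp h))
  · exact Or.inr (sub_eq_zero.mp h)

/-! ### Triple products and the existence of a dependent triple -/

/-- The triple product `h i j * h j k * h k i`. -/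
def triple (h : Matrix (Fin 9) (Fin 9) ℂ) (i j k : Fin 9) : ℂ := h i j * h j k * h k i

namespace IsPhaseMatrix

variable {h : Matrix (Fin 9) (Fin 9) ℂ}

theorem norm_triple (hh : IsPhaseMatrix h) (i j k : Fin 9) : ‖triple h i j k‖ = 1 := by
  simp [triple, hh.norm_eq]

theorem triple_left (hh : IsPhaseMatrix h) (i j : Fin 9) : triple h i j i = 1 := by
  simp [triple, hh.diag, hh.mul_star]

theorem triple_right (hh : IsPhaseMatrix h) (i j : Fin 9) : triple h i j j = 1 := by
  simp [triple, hh.diag, hh.mul_star]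

/-- Both sides are the product around the quadrilateral `i, j, k, l`, cut along its two diagonals,
whose factors cancel. -/
theorem triple_cocycle (hh : IsPhaseMatrix h) (i j k l : Fin 9) :
    triple h j k l * triple h i j l = triple h i j k * triple h i k l := by
  unfold triple
  linear_combination h j k * h k l * h i j * h l i * (hh.mul_star l j - hh.mul_star k i)

theorem sum_triple (hh : IsPhaseMatrix h) {i j : Fin 9} (hij : i ≠ j) :
    ∑ k, triple h i j k = 0 := by
  have := hh.sum_eq j i hij.symm
  simp only [triple, mul_assoc, ← Finset.mul_sum, this, mul_zero]

theorem sum_triple_sq (hh : IsPhaseMatrix h) {i j : Fin 9} (hij : i ≠ j) :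
    ∑ k, triple h i j k ^ 2 = 0 := by
  have := hh.sq.sum_triple hij
  simpa [triple, mul_pow] using this

theorem sum_triple_pow_four (hh : IsPhaseMatrix h) {i j : Fin 9} (hij : i ≠ j) :
    ∑ k, triple h i j k ^ 4 = 0 := by
  have := hh.sq.sq.sum_triple hij
  simpa [triple, mul_pow, ← pow_mul] using this

/-- If `n` of the cubes equal 1, then `6 + 3ε = 9ε + n(1 - ε)`, so `n = 6` once `ε ≠ 1`. -/
theorem exists_cube (hh : IsPhaseMatrix h)
    (hne : ∀ i j k, i ≠ j → i ≠ k → j ≠ k → triple h i j k ≠ 1) {i j : Fin 9} (hij : i ≠ j) :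
    ∃ ε : ℂ, ε ≠ 1 ∧ (∀ k, triple h i j k ^ 3 = 1 ∨ triple h i j k ^ 3 = ε) ∧
      (Finset.univ.filter fun k => triple h i j k ^ 3 = 1).card = 6 := by
  obtain ⟨ε, h1, h2⟩ := cube_eq_of_power_sums (triple h i j) (hh.norm_triple i j) hij
    (hh.triple_left i j) (hh.triple_right i j) (hh.sum_triple hij) (hh.sum_triple_sq hij)
    (hh.sum_triple_pow_four hij)
  have hε : ε ≠ 1 := by
    rintro rfl
    -- If all cubes were 1, seven primitive cube roots of unity would contribute real part -7/2
    -- against 2 from `i` and `j`.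
    have hre : ∀ k ∈ ({i, j} : Finset (Fin 9))ᶜ, (triple h i j k).re = -1 / 2 := by
      intro k hk
      simp only [Finset.mem_compl, Finset.mem_insert, Finset.mem_singleton, not_or] at hk
      have h3 : triple h i j k ^ 3 = 1 := (h1 k).elim id id
      have h4 := hne i j k hij (Ne.symm hk.1) (Ne.symm hk.2)
      have h5 : triple h i j k * star (triple h i j k) = 1 := by
        rw [Complex.star_def, Complex.mul_conj', hh.norm_triple]
        norm_num
      set z := triple h i j k
      have h6 : z ^ 2 + z + 1 = 0 := by
        have : (z - 1) * (z ^ 2 + z + 1) = 0 := by linear_combination h3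
        exact (mul_eq_zero.mp this).resolve_left (sub_ne_zero.mpr h4)
      have h7 : z + 1 + star z = 0 := by linear_combination star z * h6 - (z + 1) * h5
      have h8 := congrArg Complex.re h7
      simp at h8
      linarith
    have hs := congrArg Complex.re (hh.sum_triple hij)
    rw [Complex.re_sum, ← Finset.sum_add_sum_compl {i, j}, Finset.sum_congr rfl hre,
      Finset.sum_pair hij, hh.triple_left, hh.triple_right, Finset.sum_const, Finset.card_compl,
      Finset.card_pair hij] at hs
    norm_num at hs
  refine ⟨ε, hε, h1, ?_⟩
  have h3 : ∀ k, triple h i j k ^ 3 = ε + if triple h i j k ^ 3 = 1 then 1 - ε else 0 := by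
    intro k
    split_ifs with hk
    · rw [hk]
      ring
    · rw [(h1 k).resolve_left hk, add_zero]
  rw [Finset.sum_congr rfl fun k _ => h3 k, Finset.sum_add_distrib, ← Finset.sum_filter,
    Finset.sum_const, Finset.sum_const, Finset.card_univ, Fintype.card_fin] at h2
  set n := (Finset.univ.filter fun k => triple h i j k ^ 3 = 1).card
  have h4 : ((n : ℂ) - 6) * (1 - ε) = 0 := by
    simp only [nsmul_eq_mul, Nat.cast_ofNat] at h2
    linear_combination h2
  have h5 := (mul_eq_zero.mp h4).resolve_right (sub_ne_zero.mpr hε.symm)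
  exact_mod_cast sub_eq_zero.mp h5

theorem filter_cube_eq (hh : IsPhaseMatrix h)
    (hne : ∀ i j k, i ≠ j → i ≠ k → j ≠ k → triple h i j k ≠ 1) {i j k : Fin 9} (hij : i ≠ j)
    (hik : i ≠ k) (hk : triple h i j k ^ 3 = 1) :
    (Finset.univ.filter fun l => triple h i j l ^ 3 = 1) =
      Finset.univ.filter fun l => triple h i k l ^ 3 = 1 := by
  by_cases hjk : j = k
  · rw [hjk]
  obtain ⟨α, hα, a1, a2⟩ := hh.exists_cube hne hij
  obtain ⟨β, hβ, b1, b2⟩ := hh.exists_cube hne hik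
  obtain ⟨γ, hγ, c1, c2⟩ := hh.exists_cube hne hjk
  have hm : ∀ l, triple h j k l ^ 3 * triple h i j l ^ 3 = triple h i k l ^ 3 := by
    intro l
    rw [← mul_pow, hh.triple_cocycle, mul_pow, hk, one_mul]
  set A := Finset.univ.filter fun l => triple h i j l ^ 3 = 1 with hA
  set B := Finset.univ.filter fun l => triple h i k l ^ 3 = 1 with hB
  set D := Finset.univ.filter fun l => triple h j k l ^ 3 = 1 with hD
  have mA : ∀ l, l ∈ A ↔ triple h i j l ^ 3 = 1 := fun l => by simp [hA]
  have mB : ∀ l, l ∈ B ↔ triple h i k l ^ 3 = 1 := fun l => by simp [hB]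
  have mD : ∀ l, l ∈ D ↔ triple h j k l ^ 3 = 1 := fun l => by simp [hD]
  by_cases hαβ : α = β
  · exfalso
    -- When the exceptional values agree, `Dᶜ` is the symmetric difference of two sets of equal
    -- size, so it has even size; but it has three elements.
    have hDc : Dᶜ = (A \ B) ∪ (B \ A) := by
      ext l
      simp only [Finset.mem_compl, Finset.mem_union, Finset.mem_sdiff, mA, mB, mD]
      have h0 : triple h i j l ^ 3 ≠ 0 := pow_ne_zero 3 fun h0 => by
        have := hh.norm_triple i j l
        simp [h0] at this
      have hc : triple h j k l ^ 3 = 1 ↔ triple h i k l ^ 3 = triple h i j l ^ 3 := by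
        rw [← hm l, mul_eq_right₀ h0]
      rw [hc]
      rcases a1 l with ha | ha <;> rcases b1 l with hb | hb <;> 
        simp [ha, hb, hα, ← hαβ, hα.symm]
    have h1 := congrArg Finset.card hDc
    rw [Finset.card_union_of_disjoint disjoint_sdiff_sdiff, Finset.card_compl, c2,
      Finset.card_sdiff_comm (a2.trans b2.symm)] at h1
    simp at h1
    omega
  · have hDA : D ⊆ A := by
      intro l hl
      rw [mD] at hl
      have := hm l
      rw [mA]
      rw [hl, one_mul] at this
      rcases a1 l with ha | ha
      · exact ha
      · rcases b1 l with hb | hb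
        · exact this.trans hb
        · exact absurd (ha.symm.trans (this.trans hb)) hαβ
    have hDB : D ⊆ B := by
      intro l hl
      have h1 := (mA l).mp (hDA hl)
      rw [mB, ← hm l, h1, (mD l).mp hl, one_mul]
    rw [← Finset.eq_of_subset_of_card_le hDA (by rw [a2, c2]),
      ← Finset.eq_of_subset_of_card_le hDB (by rw [b2, c2])]

/-- In a phase matrix some triple product of distinct indices equals one. -/
theorem exists_triple_eq_one (hh : IsPhaseMatrix h) :
    ∃ i j k, i ≠ j ∧ i ≠ k ∧ j ≠ k ∧ triple h i j k = 1 := by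
  by_contra hcon
  have hne : ∀ i j k, i ≠ j → i ≠ k → j ≠ k → triple h i j k ≠ 1 :=
    fun i j k h1 h2 h3 h4 => hcon ⟨i, j, k, h1, h2, h3, h4⟩
  let A : Fin 9 → Finset (Fin 9) := fun j => Finset.univ.filter fun l => triple h 0 j l ^ 3 = 1
  have mA : ∀ j l, l ∈ A j ↔ triple h 0 j l ^ 3 = 1 := fun j l => by simp [A]
  have hcard : ∀ j, 0 ≠ j → (A j).card = 6 := fun j hj => by
    obtain ⟨_, _, _, h6⟩ := hh.exists_cube hne hj
    exact h6
  have hA : ∀ j l, 0 ≠ j → 0 ≠ l → l ∈ A j → A j = A l := fun j l hj hl hlj =>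
    hh.filter_cube_eq hne hj hl ((mA j l).mp hlj)
  obtain ⟨m, hm⟩ : ∃ m, m ∉ A 1 := by
    by_contra hall
    push Not at hall
    have h1 := hcard 1 (by decide)
    rw [Finset.eq_univ_of_forall hall] at h1
    simp at h1
  have hm0 : 0 ≠ m := by
    rintro rfl
    exact hm ((mA _ _).mpr (by simp [hh.triple_left]))
  -- A common nonzero index would force `A 1 = A m`, which contains `m`. Hence the union has at
  -- least 11 elements, too many for `Fin 9`.
  have hinter : A 1 ∩ A m ⊆ {0} := by
    intro l hl
    rw [Finset.mem_inter] at hl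
    rw [Finset.mem_singleton]
    by_contra hl0
    have h1 := hA 1 l (by decide) (Ne.symm hl0) hl.1
    have h2 := hA m l hm0 (Ne.symm hl0) hl.2
    rw [h1, ← h2] at hm
    exact hm ((mA _ _).mpr (by simp [hh.triple_right]))
  have h1 := Finset.card_union_add_card_inter (A 1) (A m)
  have h2 := Finset.card_le_card hinter
  have h3 := Finset.card_le_univ (A 1 ∪ A m)
  rw [hcard 1 (by decide), hcard m hm0] at h1
  simp at h2 h3
  omega

end IsPhaseMatrix

/-! ### Cube roots of unity and completion to a special unitary matrix -/

theorem exists_cube_root : ∃ ω : ℂ, ω ^ 2 + ω + 1 = 0 ∧ star ω = ω ^ 2 := by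
  have h3 : Real.sqrt 3 * Real.sqrt 3 = 3 := Real.mul_self_sqrt (by norm_num)
  refine ⟨⟨-1 / 2, Real.sqrt 3 / 2⟩, ?_, ?_⟩ <;> apply Complex.ext <;> simp [sq] <;>
    linarith

theorem sq_add_self_add_one {w : ℂ} (h1 : ‖w‖ = 1) (h2 : ‖1 + w‖ = 1) : w ^ 2 + w + 1 = 0 := by
  have h3 := Complex.mul_conj' w
  have h4 := Complex.mul_conj' (1 + w)
  rw [h1] at h3
  rw [h2, map_add, map_one] at h4
  push_cast at h3 h4
  linear_combination w * h4 - (w + 1) * h3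

/-- Two orthonormal rows extend to a special unitary matrix. -/
theorem exists_specialUnitary (r s : Fin 3 → ℂ) (hr : r ⬝ᵥ star r = 1) (hs : s ⬝ᵥ star s = 1)
    (hrs : r ⬝ᵥ star s = 0) :
    ∃ U : specialUnitaryGroup (Fin 3) ℂ, (U : Matrix (Fin 3) (Fin 3) ℂ) 1 = r ∧
      (U : Matrix (Fin 3) (Fin 3) ℂ) 2 = s := by
  have hsr : s ⬝ᵥ star r = 0 := by
    have h := congrArg star hrs
    rw [star_zero] at h
    rw [← h, ← star_dotProduct_star, star_star, dotProduct_comm]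
  have hstar : ∀ u v : Fin 3 → ℂ, star (crossProduct u v) = crossProduct (star u) (star v) := by
    intro u v
    ext i
    fin_cases i <;> simp [cross_apply]
  have hn : crossProduct r s ⬝ᵥ star (crossProduct r s) = 1 := by
    rw [hstar, cross_dot_cross, hr, hs, hrs, hsr]
    ring
  -- The conjugated cross product is the missing unit row, and makes the determinant `‖r × s‖² = 1`.
  let M : Matrix (Fin 3) (Fin 3) ℂ := of ![star (crossProduct r s), r, s]
  have hM : M * star M = 1 := by
    have hent : ∀ i j, (M * star M) i j = M i ⬝ᵥ star (M j) := fun i j => rfl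
    have h10 : r ⬝ᵥ crossProduct r s = 0 := dot_self_cross r s
    have h20 : s ⬝ᵥ crossProduct r s = 0 := dot_cross_self r s
    have h01 : star (crossProduct r s) ⬝ᵥ star r = 0 := by
      rw [star_dotProduct_star, h10, star_zero]
    have h02 : star (crossProduct r s) ⬝ᵥ star s = 0 := by
      rw [star_dotProduct_star, h20, star_zero]
    have h00 : star (crossProduct r s) ⬝ᵥ crossProduct r s = 1 := by rw [dotProduct_comm, hn]
    have hM0 : M 0 = star (crossProduct r s) := rfl
    have hM1 : M 1 = r := rfl
    have hM2 : M 2 = s := rfl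
    ext i j
    rw [hent]
    fin_cases i <;> fin_cases j <;>
      simp [hM0, hM1, hM2, h10, h20, h01, h02, h00, hr, hs, hrs, hsr]
  have hdet : M.det = 1 := by
    have h := triple_product_eq_det (star (crossProduct r s)) r s
    rw [dotProduct_comm, hn] at h
    exact h.symm
  exact ⟨⟨M, mem_specialUnitaryGroup_iff.mpr ⟨mem_unitaryGroup_iff.mpr hM, hdet⟩⟩, rfl, rfl⟩

/-! ### The orthonormal frame of a dependent triple -/

namespace IsEquiangular

variable {x : Fin 9 → Fin 3 → ℂ} {κ : ℂ} {a b c : Fin 9}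

/-- A linear form supported on three of the vectors, with phases adjusted. -/
def form (x : Fin 9 → Fin 3 → ℂ) (a b c : Fin 9) (α β γ : ℂ) : Fin 3 → ℂ :=
  α • star (x a) + (β * phaseMatrix x a b) • star (x b) + (γ * phaseMatrix x a c) • star (x c)

theorem form_dotProduct (α β γ : ℂ) (z : Fin 3 → ℂ) :
    form x a b c α β γ ⬝ᵥ z = α * (star (x a) ⬝ᵥ z) + β * phaseMatrix x a b * (star (x b) ⬝ᵥ z) +
      γ * phaseMatrix x a c * (star (x c) ⬝ᵥ z) := by
  simp [form, add_dotProduct, smul_dotProduct]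

theorem star_form (α β γ : ℂ) :
    star (form x a b c α β γ) = star α • x a + (star β * phaseMatrix x b a) • x b +
      (star γ * phaseMatrix x c a) • x c := by
  simp only [form, star_add, star_smul, star_mul', star_star, star_phaseMatrix]

theorem dotProduct_eq (x : Fin 9 → Fin 3 → ℂ) {i j : Fin 9} (hij : i ≠ j) :
    star (x i) ⬝ᵥ x j = -phaseMatrix x i j / 2 := by
  rw [phaseMatrix_ne x hij]
  ring

/-- Three indices whose vectors are linearly dependent. -/
structure IsDependentTriple (x : Fin 9 → Fin 3 → ℂ) (a b c : Fin 9) : Prop where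
  ab : a ≠ b
  ac : a ≠ c
  bc : b ≠ c
  triple_eq : triple (phaseMatrix x) a b c = 1

theorem form_dotProduct_first (hx : IsEquiangular x κ) (ht : IsDependentTriple x a b c) (α β γ : ℂ) :
    form x a b c α β γ ⬝ᵥ x a = α - (β + γ) / 2 := by
  rw [form_dotProduct, hx.unit, dotProduct_eq x ht.ab.symm, dotProduct_eq x ht.ac.symm]
  linear_combination -(β / 2) * hx.isPhaseMatrix.mul_star a b -
    (γ / 2) * hx.isPhaseMatrix.mul_star a c

theorem form_dotProduct_second (hx : IsEquiangular x κ) (ht : IsDependentTriple x a b c) (α β γ : ℂ) :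
    form x a b c α β γ ⬝ᵥ x b = phaseMatrix x a b * (β - (α + γ) / 2) := by
  rw [form_dotProduct, hx.unit, dotProduct_eq x ht.ab, dotProduct_eq x ht.bc.symm]
  have h1 := hx.isPhaseMatrix.mul_star a c
  have h2 := hx.isPhaseMatrix.mul_star b c
  have habc := ht.triple_eq
  unfold triple at habc
  linear_combination γ / 2 * (phaseMatrix x a c * phaseMatrix x c b * habc) -
    γ / 2 * phaseMatrix x a b * (phaseMatrix x b c * phaseMatrix x c b * h1 + h2)

theorem form_dotProduct_third (hx : IsEquiangular x κ) (ht : IsDependentTriple x a b c) (α β γ : ℂ) :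
    form x a b c α β γ ⬝ᵥ x c = phaseMatrix x a c * (γ - (α + β) / 2) := by
  rw [form_dotProduct, hx.unit, dotProduct_eq x ht.ac, dotProduct_eq x ht.bc]
  have h1 := hx.isPhaseMatrix.mul_star a c
  have habc := ht.triple_eq
  unfold triple at habc
  linear_combination β / 2 * phaseMatrix x a b * phaseMatrix x b c * h1 -
    β / 2 * phaseMatrix x a c * habc

/-- With phases absorbed, triple product 1 turns the Gram matrix of the triple into the real matrix
with diagonal 1 and off-diagonal entries -1/2, which has `(1, 1, 1)` in its kernel. -/
theorem form_dotProduct_star_form (hx : IsEquiangular x κ) (ht : IsDependentTriple x a b c) (α β γ α' β' γ' : ℂ) :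
    form x a b c α β γ ⬝ᵥ star (form x a b c α' β' γ') =
      star α' * (α - (β + γ) / 2) + star β' * (β - (α + γ) / 2) +
        star γ' * (γ - (α + β) / 2) := by
  rw [star_form, dotProduct_add, dotProduct_add, dotProduct_smul, dotProduct_smul, dotProduct_smul,
    hx.form_dotProduct_first ht, hx.form_dotProduct_second ht,
    hx.form_dotProduct_third ht]
  simp only [smul_eq_mul]
  linear_combination star β' * (β - (α + γ) / 2) * hx.isPhaseMatrix.mul_star a b +
    star γ' * (γ - (α + β) / 2) * hx.isPhaseMatrix.mul_star a c

open ComplexOrder in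
theorem form_one_eq_zero (hx : IsEquiangular x κ) (ht : IsDependentTriple x a b c) : form x a b c 1 1 1 = 0 := by
  rw [← dotProduct_star_self_eq_zero, dotProduct_comm, hx.form_dotProduct_star_form ht]
  norm_num

/-- The product of a vector outside the triple with a linear form supported on the triple. -/
theorem form_dotProduct_other (hx : IsEquiangular x κ) (ht : IsDependentTriple x a b c) {l : Fin 9} (hla : l ≠ a) (hlb : l ≠ b) (α β γ : ℂ) :
    form x a b c α β γ ⬝ᵥ x l = -phaseMatrix x a l / 2 *
      (α + β * triple (phaseMatrix x) a b l - γ * (1 + triple (phaseMatrix x) a b l)) := by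
  have h0 : form x a b c 1 1 1 ⬝ᵥ x l = 0 := by
    rw [hx.form_one_eq_zero ht, zero_dotProduct]
  rw [form_dotProduct, dotProduct_eq x hla.symm, dotProduct_eq x hlb.symm] at h0 ⊢
  have h1 := hx.isPhaseMatrix.mul_star a l
  unfold triple
  linear_combination γ * h0 + (β - γ) / 2 * phaseMatrix x a b * phaseMatrix x b l * h1

/-- Pairing the relation of the triple with `x l` gives three numbers of equal modulus and sum zero,
so their ratios are primitive cube roots of unity. -/
theorem triple_sq_add (hx : IsEquiangular x κ) (ht : IsDependentTriple x a b c) {l : Fin 9} (hla : l ≠ a) (hlb : l ≠ b) (hlc : l ≠ c) :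
    triple (phaseMatrix x) a b l ^ 2 + triple (phaseMatrix x) a b l + 1 = 0 := by
  refine sq_add_self_add_one (hx.isPhaseMatrix.norm_triple a b l) ?_
  have h := hx.form_dotProduct_other ht hla hlb 0 0 (-1)
  rw [form_dotProduct, dotProduct_eq x hlc.symm] at h
  have h' := congrArg norm h
  simp [hx.norm_phaseMatrix] at h'
  exact h'

/-- The vectors of an equiangular family split into three triples, adapted to an orthonormal
basis. -/
theorem exists_frame (hx : IsEquiangular x κ) :
    ∃ r s : Fin 3 → ℂ, r ⬝ᵥ star r = 1 ∧ s ⬝ᵥ star s = 1 ∧ r ⬝ᵥ star s = 0 ∧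
      ∃ σ : Fin 9 → Fin 3, (∀ m, (Finset.univ.filter fun k => σ k = m).card = 3) ∧
        ∀ k, (σ k = 0 → ‖r ⬝ᵥ x k‖ ^ 2 = 1 / 2 ∧ ‖s ⬝ᵥ x k‖ ^ 2 = 1 / 2) ∧
          (σ k = 1 → r ⬝ᵥ x k = 0 ∧ ‖s ⬝ᵥ x k‖ ^ 2 = 1 / 2) ∧
          (σ k = 2 → s ⬝ᵥ x k = 0 ∧ ‖r ⬝ᵥ x k‖ ^ 2 = 1 / 2) := by
  obtain ⟨a, b, c, hab, hac, hbc, habc⟩ := hx.isPhaseMatrix.exists_triple_eq_one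
  have ht : IsDependentTriple x a b c := ⟨hab, hac, hbc, habc⟩
  obtain ⟨ω, hω, hωs⟩ := exists_cube_root
  have hω3 : ω ^ 3 = 1 := by linear_combination (ω - 1) * hω
  have hωs2 : star (ω ^ 2) = ω := by
    rw [star_pow, hωs]
    linear_combination ω * hω3
  have hωn : ‖ω‖ = 1 := by
    have h := Complex.mul_conj' ω
    rw [← Complex.star_def, hωs, ← pow_succ', hω3] at h
    have h' : ‖ω‖ ^ 2 = 1 := by exact_mod_cast h.symm
    exact (pow_eq_one_iff_of_nonneg (norm_nonneg _) two_ne_zero).mp h'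
  -- The Fourier forms below have squared norm `3 · 3/2 = 9/2`, hence the scale `√(2/9)`.
  set d : ℂ := ((Real.sqrt 2 / 3 : ℝ) : ℂ) with hd
  have hds : star d = d := Complex.conj_ofReal _
  have hd2 : d ^ 2 = 2 / 9 := by
    rw [hd, ← Complex.ofReal_pow, div_pow, Real.sq_sqrt (by norm_num)]
    norm_num
  have hdn : ‖d‖ ^ 2 = 2 / 9 := by
    rw [← norm_pow, hd2]
    norm_num
  have hn : ∀ p z : ℂ, ‖p‖ = 1 → ‖z‖ = 3 / 2 → ‖d * (p * z)‖ ^ 2 = 1 / 2 := by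
    intro p z hp hz
    rw [norm_mul, norm_mul, mul_pow, hdn, hp, hz]
    norm_num
  set h := phaseMatrix x with hh
  have hnorm : ∀ i j, ‖h i j‖ = 1 := hx.norm_phaseMatrix
  let w : Fin 9 → ℂ := triple h a b
  -- The labels are matched to the forms chosen below: `w l = ω` annihilates `s`, and `w l = ω²`
  -- annihilates `r`.
  let σ : Fin 9 → Fin 3 := fun l => if w l = 1 then 0 else if w l = ω then 2 else 1
  have hω1 : ω ≠ 1 := by
    rintro rfl
    norm_num at hω
  have hw_in : ∀ l, l = a ∨ l = b ∨ l = c → w l = 1 := by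
    rintro l (rfl | rfl | rfl)
    · exact hx.isPhaseMatrix.triple_left _ _
    · exact hx.isPhaseMatrix.triple_right _ _
    · exact habc
  have hw_out : ∀ l, ¬(l = a ∨ l = b ∨ l = c) → w l = ω ∨ w l = ω ^ 2 := by
    intro l hl
    simp only [not_or] at hl
    have h1 := hx.triple_sq_add ht hl.1 hl.2.1 hl.2.2
    have h2 : (w l - ω) * (w l - ω ^ 2) = 0 := by
      linear_combination h1 - w l * hω + hω3
    exact (mul_eq_zero.mp h2).imp sub_eq_zero.mp sub_eq_zero.mp
  have hω2 : ω ^ 2 ≠ 1 := fun h2 => hω1 (by linear_combination hω3 - ω * h2)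
  have hωω : ω ^ 2 ≠ ω := fun h2 => hω1 (by linear_combination hω3 - (ω + 1) * h2)
  have hw_iff : ∀ l, w l = 1 ↔ l = a ∨ l = b ∨ l = c := by
    intro l
    refine ⟨fun h1 => ?_, hw_in l⟩
    by_contra h2
    rcases hw_out l h2 with h3 | h3
    · exact hω1 (h3.symm.trans h1)
    · exact hω2 (h3.symm.trans h1)
  refine ⟨d • form x a b c 1 (ω ^ 2) ω, d • form x a b c 1 ω (ω ^ 2), ?_, ?_, ?_, σ, ?_, ?_⟩
  · rw [star_smul, smul_dotProduct, dotProduct_smul, hx.form_dotProduct_star_form ht, hds, hωs,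
      hωs2, star_one]
    simp only [smul_eq_mul]
    linear_combination 9 / 2 * hd2 + d ^ 2 * (2 * hω3 - 3 / 2 * hω - ω / 2 * hω3)
  · rw [star_smul, smul_dotProduct, dotProduct_smul, hx.form_dotProduct_star_form ht, hds, hωs,
      hωs2, star_one]
    simp only [smul_eq_mul]
    linear_combination 9 / 2 * hd2 + d ^ 2 * (2 * hω3 - 3 / 2 * hω - ω / 2 * hω3)
  · rw [star_smul, smul_dotProduct, dotProduct_smul, hx.form_dotProduct_star_form ht, hds, hωs,
      hωs2, star_one]
    simp only [smul_eq_mul]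
    linear_combination d ^ 2 * (ω * hω3 - hω3)
  · have h0 : (Finset.univ.filter fun k => σ k = 0).card = 3 := by
      rw [Finset.card_eq_three]
      refine ⟨a, b, c, hab, hac, hbc, ?_⟩
      ext l
      simp only [Finset.mem_filter_univ, Finset.mem_insert, Finset.mem_singleton, ← hw_iff]
      by_cases h1 : w l = 1
      · simp [σ, h1]
      · by_cases h2 : w l = ω <;> simp [σ, h1, h2, hω1]
    have hval : ∀ l, w l = (if σ l = 0 then 1 else 0) + (if σ l = 1 then ω ^ 2 else 0) +
        if σ l = 2 then ω else 0 := by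
      intro l
      by_cases hl : l = a ∨ l = b ∨ l = c
      · simp [σ, hw_in l hl]
      · rcases hw_out l hl with h1 | h1
        · simp [σ, h1, hω1]
        · simp [σ, h1, hω2, hωω]
    have hone : ∀ l, (1 : ℕ) = (if σ l = 0 then 1 else 0) + (if σ l = 1 then 1 else 0) +
        if σ l = 2 then 1 else 0 := by
      intro l
      generalize σ l = m
      fin_cases m <;> simp
    have hsum : ∑ l, w l = 0 := hx.isPhaseMatrix.sum_triple hab
    rw [Finset.sum_congr rfl fun l _ => hval l] at hsum
    have hcard : ∑ l : Fin 9, (1 : ℕ) = 9 := by simp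
    rw [Finset.sum_congr rfl fun l _ => hone l] at hcard
    simp only [Finset.sum_add_distrib, ← Finset.sum_filter, Finset.sum_const, nsmul_eq_mul,
      smul_eq_mul, mul_one, h0, Nat.cast_ofNat] at hsum hcard
    set n₁ := (Finset.univ.filter fun k => σ k = 1).card with hn₁
    set n₂ := (Finset.univ.filter fun k => σ k = 2).card with hn₂
    have hcard' : (3 : ℂ) + n₁ + n₂ = 9 := by exact_mod_cast hcard
    -- The vanishing sum of triple products reads `3 + n₁ω² + n₂ω = 0`, to be combined with `n₁ + n₂
    -- = 6`.
    have h1 : ((n₁ : ℂ) - 3) * (1 + 2 * ω) = 0 := by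
      linear_combination (-1 : ℂ) * hsum + ω * hcard' + n₁ * hω
    have h2 : 1 + 2 * ω ≠ 0 := by
      intro h2
      have : (3 : ℂ) = 0 := by linear_combination 4 * hω - (1 + 2 * ω) * h2
      norm_num at this
    have h3 : n₁ = 3 := by
      exact_mod_cast sub_eq_zero.mp ((mul_eq_zero.mp h1).resolve_right h2)
    intro m
    fin_cases m
    · exact h0
    · exact h3
    · change n₂ = 3
      omega
  · have e1 : 1 - (ω ^ 2 + ω) / 2 = 3 / 2 := by linear_combination -hω / 2
    have e1' : 1 - (ω + ω ^ 2) / 2 = 3 / 2 := by linear_combination -hω / 2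
    have e2 : ω ^ 2 - (1 + ω) / 2 = 3 / 2 * ω ^ 2 := by linear_combination -hω / 2
    have e3 : ω - (1 + ω ^ 2) / 2 = 3 / 2 * ω := by linear_combination -hω / 2
    have n1 : ‖(3 / 2 : ℂ)‖ = 3 / 2 := by norm_num
    have n2 : ‖(3 / 2 : ℂ) * ω ^ 2‖ = 3 / 2 := by rw [norm_mul, norm_pow, hωn, n1]; norm_num
    have n3 : ‖(3 / 2 : ℂ) * ω‖ = 3 / 2 := by rw [norm_mul, hωn, n1]; norm_num
    intro k
    simp only [smul_dotProduct, smul_eq_mul]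
    by_cases hk : k = a ∨ k = b ∨ k = c
    · have hσ : σ k = 0 := by simp [σ, hw_in k hk]
      rw [hσ]
      refine ⟨fun _ => ?_, by simp, by simp⟩
      rcases hk with rfl | rfl | rfl
      · rw [hx.form_dotProduct_first ht, hx.form_dotProduct_first ht, e1, e1']
        have := hn 1 (3 / 2) norm_one n1
        rw [one_mul] at this
        exact ⟨this, this⟩
      · rw [hx.form_dotProduct_second ht, hx.form_dotProduct_second ht, e2, e3]
        exact ⟨hn _ _ (hnorm _ _) n2, hn _ _ (hnorm _ _) n3⟩
      · rw [hx.form_dotProduct_third ht, hx.form_dotProduct_third ht, e2, e3]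
        exact ⟨hn _ _ (hnorm _ _) n3, hn _ _ (hnorm _ _) n2⟩
    · have hk' := hk
      simp only [not_or] at hk'
      rw [hx.form_dotProduct_other ht hk'.1 hk'.2.1, hx.form_dotProduct_other ht hk'.1 hk'.2.1]
      have hwk : triple (phaseMatrix x) a b k = w k := rfl
      rw [hwk]
      rcases hw_out k hk with h1 | h1
      · have hσ : σ k = 2 := by simp [σ, h1, hω1]
        rw [hσ, h1]
        refine ⟨by simp, by simp, fun _ => ⟨?_, ?_⟩⟩
        · linear_combination d * h a k / 2 * hω3
        · rw [show -phaseMatrix x a k / 2 * (1 + ω ^ 2 * ω - ω * (1 + ω)) = -h a k * (3 / 2) by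
            linear_combination -h a k / 2 * (hω3 - hω)]
          exact hn _ _ ((norm_neg _).trans (hnorm _ _)) n1
      · have hσ : σ k = 1 := by simp [σ, h1, hω2, hωω]
        rw [hσ, h1]
        refine ⟨by simp, fun _ => ⟨?_, ?_⟩, by simp⟩
        · linear_combination -d * h a k / 2 * (ω - 1) * hω3
        · rw [show -phaseMatrix x a k / 2 * (1 + ω * ω ^ 2 - ω ^ 2 * (1 + ω ^ 2)) =
              -h a k * (3 / 2) by linear_combination -h a k / 2 * ((1 - ω) * hω3 - hω)]
          exact hn _ _ ((norm_neg _).trans (hnorm _ _)) n1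

end IsEquiangular

/-! ### The action on projective space and the midpoint solution -/

theorem suAct_mk {n : ℕ} (U : specialUnitaryGroup (Fin n) ℂ) (z : V n) (hz : z ≠ 0) :
    ∃ hz', suAct U (Projectivization.mk ℂ z hz) =
      Projectivization.mk ℂ (toEuclideanLin (U : Matrix (Fin n) (Fin n) ℂ) z) hz' :=
  ⟨_, Projectivization.map_mk _ _ _ _⟩

theorem suAct_injective {n : ℕ} (U : specialUnitaryGroup (Fin n) ℂ) :
    Function.Injective (suAct U) :=
  Projectivization.map_injective _ (toEuclideanLin_injective U)

theorem inner_toEuclideanLin {n : ℕ} (U : specialUnitaryGroup (Fin n) ℂ) (w z : V n) :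
    inner ℂ (toEuclideanLin (U : Matrix (Fin n) (Fin n) ℂ) w)
      (toEuclideanLin (U : Matrix (Fin n) (Fin n) ℂ) z) = inner ℂ w z := by
  have hU : star (U : Matrix (Fin n) (Fin n) ℂ) * U = 1 :=
    mem_unitaryGroup_iff'.mp (mem_specialUnitaryGroup_iff.mp U.2).1
  rw [EuclideanSpace.inner_eq_star_dotProduct, EuclideanSpace.inner_eq_star_dotProduct,
    toLpLin_apply, toLpLin_apply, star_mulVec, dotProduct_comm, ← dotProduct_mulVec,
    mulVec_mulVec, ← star_eq_conjTranspose, hU, one_mulVec, dotProduct_comm]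

theorem norm_toEuclideanLin {n : ℕ} (U : specialUnitaryGroup (Fin n) ℂ) (z : V n) :
    ‖toEuclideanLin (U : Matrix (Fin n) (Fin n) ℂ) z‖ = ‖z‖ := by
  rw [@norm_eq_sqrt_re_inner ℂ, @norm_eq_sqrt_re_inner ℂ, inner_toEuclideanLin]

theorem crossRatio_suAct {n : ℕ} (U : specialUnitaryGroup (Fin n) ℂ) (p q : CP n) :
    crossRatio (suAct U p) (suAct U q) = crossRatio p q := by
  obtain ⟨w, hw, rfl⟩ : ∃ w hw, p = Projectivization.mk ℂ w hw :=
    ⟨p.rep, p.rep_nonzero, p.mk_rep.symm⟩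
  obtain ⟨z, hz, rfl⟩ : ∃ z hz, q = Projectivization.mk ℂ z hz :=
    ⟨q.rep, q.rep_nonzero, q.mk_rep.symm⟩
  obtain ⟨hw', h1⟩ := suAct_mk U w hw
  obtain ⟨hz', h2⟩ := suAct_mk U z hz
  rw [h1, h2, crossRatio_mk, crossRatio_mk, inner_toEuclideanLin, norm_toEuclideanLin,
    norm_toEuclideanLin]

theorem IsSICSet.image_suAct {n : ℕ} {S : Set (CP n)} (hS : IsSICSet S)
    (U : specialUnitaryGroup (Fin n) ℂ) : IsSICSet (suAct U '' S) := by
  obtain ⟨hcard, κ, h0, h1, hκ⟩ := hS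
  refine ⟨by rw [Set.ncard_image_of_injective _ (suAct_injective U), hcard], κ, h0, h1, ?_⟩
  rintro _ ⟨p, hp, rfl⟩ _ ⟨q, hq, rfl⟩ hpq
  rw [crossRatio_suAct]
  exact hκ p hp q hq fun h => hpq (by rw [h])

/-- A second vanishing coordinate would, by equality of moduli, make all coordinates vanish.
Disjointness is what lets the fibres of `σ` count the points on each circle. -/
theorem eq_of_mem_circle {i j : Fin 3} {p : CP 3} (hi : p ∈ circle i) (hj : p ∈ circle j) :
    i = j := by
  by_contra hij
  obtain ⟨z, hz, rfl, h1, h2⟩ := hi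
  obtain ⟨w, hw, h3, h4, h5⟩ := hj
  obtain ⟨a, ha⟩ := (Projectivization.mk_eq_mk_iff ℂ _ _ hz hw).mp h3
  have hzj : z j = 0 := by
    rw [← ha]
    simp [Units.smul_def, h4]
  apply hz
  ext k
  by_cases hk : k = i
  · rw [hk, h1]
    rfl
  · have := h2 k j hk (Ne.symm hij)
    rw [hzj, norm_zero, norm_eq_zero] at this
    rw [this]
    rfl

/-- The points of a SIC set in the projective plane are represented by an equiangular family. -/
theorem IsSICSet.exists_isEquiangular {S : Set (CP 3)} (hS : IsSICSet S) :
    ∃ (x : Fin 9 → V 3) (hx : ∀ i, x i ≠ 0) (κ : ℂ),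
      IsEquiangular (fun i => (x i).ofLp) κ ∧ (∀ i, ‖x i‖ = 1) ∧
        Function.Injective (fun i => Projectivization.mk ℂ (x i) (hx i)) ∧
        Set.range (fun i => Projectivization.mk ℂ (x i) (hx i)) = S := by
  obtain ⟨hcard, κ, h0, h1, hκ⟩ := hS
  have hfin : S.Finite := Set.finite_of_ncard_ne_zero (by rw [hcard]; norm_num)
  have : Fintype S := hfin.fintype
  have hc : Fintype.card S = 9 := by
    rw [← Nat.card_eq_fintype_card, Nat.card_coe_set_eq, hcard]
    norm_num
  let e : Fin 9 ≃ S := (Fintype.equivFinOfCardEq hc).symm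
  let x : Fin 9 → V 3 := fun i => ((‖(e i : CP 3).rep‖⁻¹ : ℝ) : ℂ) • (e i : CP 3).rep
  have hrep : ∀ i, ‖(e i : CP 3).rep‖ ≠ 0 := fun i => norm_ne_zero_iff.mpr (e i : CP 3).rep_nonzero
  have hnorm : ∀ i, ‖x i‖ = 1 := by
    intro i
    rw [norm_smul, Complex.norm_real, norm_inv, norm_norm, inv_mul_cancel₀ (hrep i)]
  have hx : ∀ i, x i ≠ 0 := fun i h => by
    have := hnorm i
    rw [h, norm_zero] at this
    exact zero_ne_one this
  have hmk : ∀ i, Projectivization.mk ℂ (x i) (hx i) = (e i : CP 3) := by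
    intro i
    conv_rhs => rw [← (e i : CP 3).mk_rep]
    rw [Projectivization.mk_eq_mk_iff']
    exact ⟨_, rfl⟩
  have hdot : ∀ i j, star (x i).ofLp ⬝ᵥ (x j).ofLp = inner ℂ (x i) (x j) := fun i j => by
    rw [EuclideanSpace.inner_eq_star_dotProduct, dotProduct_comm]
  refine ⟨x, hx, (κ : ℂ), ⟨by exact_mod_cast h1.ne, fun i => ?_, fun i j hij => ?_⟩, hnorm, ?_, ?_⟩
  · rw [hdot, inner_self_eq_norm_sq_to_K, hnorm]
    norm_num
  · have hne : (e i : CP 3) ≠ e j := fun h => hij (e.injective (Subtype.ext h))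
    have h := hκ _ (e i).2 _ (e j).2 hne
    rw [← hmk i, ← hmk j, crossRatio_mk, hnorm, hnorm] at h
    rw [hdot, hdot, ← inner_conj_symm (x j) (x i), Complex.mul_conj', ← h]
    norm_num
  · intro i j hij
    exact e.injective (Subtype.ext (by simpa only [hmk] using hij))
  · ext p
    simp only [hmk, Set.mem_range]
    constructor
    · rintro ⟨i, rfl⟩
      exact (e i).2
    · intro hp
      exact ⟨e.symm ⟨p, hp⟩, by simp⟩

end SIC

theorem theorem5p2 (S : Set (SIC.CP 3)) (hS : SIC.IsSICSet S) :
    ∃ T : Set (SIC.CP 3), SIC.IsMidpointSolution T ∧ SIC.CongruentModSU S T := by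
  obtain ⟨x, hx0, κ, hx, hnorm, hinj, hrange⟩ := hS.exists_isEquiangular
  obtain ⟨r, s, hr, hs, hrs, σ, hσ, hk⟩ := hx.exists_frame
  obtain ⟨U, hU1, hU2⟩ := SIC.exists_specialUnitary r s hr hs hrs
  set y : Fin 9 → SIC.CP 3 := fun i => Projectivization.mk ℂ (x i) (hx0 i) with hy
  have hcircle : ∀ k, SIC.suAct U (y k) ∈ SIC.circle (σ k) := by
    intro k
    obtain ⟨hz', h⟩ := SIC.suAct_mk U (x k) (hx0 k)
    refine ⟨_, hz', h, ?_⟩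
    have hn := SIC.norm_toEuclideanLin U (x k)
    set z := Matrix.toEuclideanLin (U : Matrix (Fin 3) (Fin 3) ℂ) (x k) with hz
    have hz1 : z 1 = r ⬝ᵥ (x k).ofLp := by rw [← hU1]; rfl
    have hz2 : z 2 = s ⬝ᵥ (x k).ofLp := by rw [← hU2]; rfl
    -- The frame controls only coordinates 1 and 2; the modulus of coordinate 0 comes from the unit
    -- norm.
    have hsum : ‖z 0‖ ^ 2 + ‖z 1‖ ^ 2 + ‖z 2‖ ^ 2 = 1 := by
      rw [hnorm] at hn
      rw [← Fin.sum_univ_three fun i => ‖z i‖ ^ 2, ← EuclideanSpace.norm_sq_eq, hn, one_pow]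
    have hk := hk k
    rw [← hz1, ← hz2] at hk
    have key : ∀ i : Fin 3, z i = 0 → (∀ j, j ≠ i → ‖z j‖ ^ 2 = 1 / 2) →
        z i = 0 ∧ ∀ j k, j ≠ i → k ≠ i → ‖z j‖ = ‖z k‖ := fun i h1 h2 =>
      ⟨h1, fun j k hj hk => (sq_eq_sq₀ (norm_nonneg _) (norm_nonneg _)).mp
        ((h2 j hj).trans (h2 k hk).symm)⟩
    obtain h0 | h0 | h0 : σ k = 0 ∨ σ k = 1 ∨ σ k = 2 := by
      generalize σ k = m
      fin_cases m <;> simp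
    · obtain ⟨h1, h2⟩ := hk.1 h0
      rw [h0]
      refine key 0 ?_ fun j hj => ?_
      · rw [h1, h2] at hsum
        exact norm_eq_zero.mp (pow_eq_zero_iff two_ne_zero |>.mp (by linarith))
      · fin_cases j
        · exact absurd rfl hj
        · exact h1
        · exact h2
    · obtain ⟨h1, h2⟩ := hk.2.1 h0
      rw [h0]
      refine key 1 h1 fun j hj => ?_
      rw [h1, h2, norm_zero] at hsum
      fin_cases j
      · change ‖z 0‖ ^ 2 = 1 / 2
        linarith
      · exact absurd rfl hj
      · exact h2
    · obtain ⟨h1, h2⟩ := hk.2.2 h0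
      rw [h0]
      refine key 2 h1 fun j hj => ?_
      rw [h1, h2, norm_zero] at hsum
      fin_cases j
      · change ‖z 0‖ ^ 2 = 1 / 2
        linarith
      · exact h2
      · exact absurd rfl hj
  refine ⟨SIC.suAct U '' S, ⟨hS.image_suAct U, ?_, ?_⟩, U, rfl⟩
  · rw [← hrange]
    rintro _ ⟨_, ⟨k, rfl⟩, rfl⟩
    exact Set.mem_iUnion.mpr ⟨σ k, hcircle k⟩
  · intro m
    have himg : SIC.suAct U '' S ∩ SIC.circle m =
        (SIC.suAct U ∘ y) '' (Finset.univ.filter fun k => σ k = m : Finset (Fin 9)) := by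
      ext p
      constructor
      · rintro ⟨⟨q, hq, rfl⟩, hp⟩
        rw [← hrange] at hq
        obtain ⟨k, rfl⟩ := hq
        exact ⟨k, by simpa using SIC.eq_of_mem_circle (hcircle k) hp, rfl⟩
      · rintro ⟨k, hkm, rfl⟩
        have hkm : σ k = m := by simpa using hkm
        exact ⟨⟨_, hrange ▸ ⟨k, rfl⟩, rfl⟩, hkm ▸ hcircle k⟩
    rw [himg, Set.ncard_image_of_injective _ ((SIC.suAct_injective U).comp hinj),
      Set.ncard_coe_finset, hσ m]
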